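/- Let $m,n,s$ be integers with $1\le s\le n$ and $m\ge 1$, let $\delta,\eta\in(0,1)$, and put $\sigma=\frac1m\frac{\sqrt2}{\sqrt\pi}$. Let $\Phi$ be an $m\times n$ random matrix with independent, identically distributed complex entries whose real and imaginary parts are independent real normal variables, each of distribution $\mathcal N(0,\sigma^2)$ (that is, the entries are circular complex Gaussian variables with mean $0$ and total variance $\mathbb E|\Phi_{ij}|^2=2\sigma^2$). If $$m\;\ge\;\frac{36}{\pi}\,\delta^{-2}\Big[s\log\Big(\frac{en}{s}\Big(1+\frac6\delta\Big)^2\Big)+\log\frac2\eta\Big],$$ then, with probability exceeding $1-\eta$, the matrix $\Phi$ satisfies the complex $(\ell_1,\ell_2)$-RIP$(s,\delta)$, i.e. $$(1-\delta)\|x\|_2\;\le\;\|\Phi x\|_1\;\le\;(1+\delta)\|x\|_2\qquad\text{simultaneously for all } x\in\mathbb C^n \text{ with at most } s \text{ nonzero coordinates},$$ where $\|u\|_p=(\sum_i|u_i|^p)^{1/p}$. -/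

import Mathlib

open MeasureTheory ProbabilityTheory
open scoped NNReal Matrix

noncomputable section

/-- The complex normal distribution with mean `z` and total variance `v`: the law of `g + i g'`
with `g`, `g'` independent real normal variables of means `Re z`, `Im z`, each of variance
`v / 2`. -/
def complexNormal (z : ℂ) (v : ℝ≥0) : Measure ℂ :=
  ((gaussianReal z.re (v / 2)).prod (gaussianReal z.im (v / 2))).map
    Complex.measurableEquivRealProd.symm

/-- `Φ` is an `m × n` random matrix with i.i.d. complex normal entries of mean `z` and total
variance `v`. -/
structure IsComplexGaussianMatrix {Ω : Type*} [MeasurableSpace Ω] (P : Measure Ω) {m n : ℕ}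
    (z : ℂ) (v : ℝ≥0) (Φ : Ω → Matrix (Fin m) (Fin n) ℂ) : Prop where
  hasLaw : ∀ i j, HasLaw (fun ω => Φ ω i j) (complexNormal z v) P
  indep : iIndepFun (fun (p : Fin m × Fin n) ω => Φ ω p.1 p.2) P

/-- The set of `s`-sparse vectors of `ℂⁿ`: at most `s` nonzero coordinates. -/
def sparseVectors (n s : ℕ) : Set (Fin n → ℂ) :=
  {x | (Function.support x).ncard ≤ s}

/-- The complex `(ℓ₁, ℓ₂)`-restricted isometry property of order `s` and distortion `δ`. -/
def SatisfiesRIP {m n : ℕ} (A : Matrix (Fin m) (Fin n) ℂ) (s : ℕ) (δ : ℝ) : Prop :=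
  ∀ x ∈ sparseVectors n s,
    (1 - δ) * ‖WithLp.toLp 2 x‖ ≤ ‖WithLp.toLp 1 (A *ᵥ x)‖ ∧
      ‖WithLp.toLp 1 (A *ᵥ x)‖ ≤ (1 + δ) * ‖WithLp.toLp 2 x‖

end

/-!
For a fixed unit vector `x`, the coordinates of `Φ x` are independent complex normal variables with
the law of an entry of `Φ` (`hasLaw_sum_mul_complexNormal`, `iIndepFun_rows`), so that `‖Φ x‖₁` is a
sum of `m` independent Rayleigh variables; the choice of `σ` gives each of them the mean `1 / m`.
A Rayleigh variable `σ R` is sub-Gaussian around its mean with variance proxy `σ²`, and Chernoff's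
bound gives `|‖Φ x‖₁ - 1| < t` up to probability `2 exp (-π m t² / 4)`
(`measureReal_abs_norm_mulVec_sub_one_ge_le`).

The sharp variance proxy is obtained without the general theory of Gaussian concentration. In polar
coordinates, `𝔼 exp (t R) = exp (t² / 2) H t`, where `H t = exp (-t² / 2) + t G t` and `G` is the
integral of `exp (-u² / 2)` over `(-∞, t]`. Since `H' = G`, the required bound
`H t ≤ exp (t √(π / 2))` compares `log H` with its tangent line at the origin, and follows from the
log-concavity `H'' H ≤ H' ^ 2`. The latter is proved by differentiating: each of the functions
`G + t H` and `H' ^ 2 - H'' H` vanishes at `-∞` and has a nonnegative derivative.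

Uniformity over sparse vectors is the usual net argument. Every coordinate subspace of complex
dimension `s` has real dimension `2 s`, so its unit sphere has a `δ / 3`-net of cardinality at most
`(1 + 6 / δ) ^ (2 s)` by comparison of volumes (`exists_net_unit_sphere`), and an operator which
distorts the norm by at most `δ / 3` on the net distorts it by at most `δ` everywhere
(`norm_bounds_of_net`). A union bound over the `n.choose s` subspaces and their nets, with
`t = δ / 3`, gives the theorem; the inequality is strict because `n.choose s < (e n / s) ^ s`.
-/

open Filter Topology

/-! ### The Gaussian integral and the log-concavity of its primitive -/

/-- The unnormalised distribution function `t ↦ ∫_{-∞}^t exp (-u² / 2) du` of the standard normal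
law. -/
noncomputable def gaussLowerTail (t : ℝ) : ℝ := ∫ u in Set.Iic t, Real.exp (-u ^ 2 / 2)

lemma integrable_exp_neg_sq_div_two : Integrable (fun u : ℝ => Real.exp (-u ^ 2 / 2)) := by
  have h := integrable_exp_neg_mul_sq (b := 1 / 2) (by norm_num)
  refine h.congr (ae_of_all _ fun u => ?_)
  simp only
  congr 1
  ring

lemma integral_exp_neg_sq_div_two : ∫ u : ℝ, Real.exp (-u ^ 2 / 2) = √(2 * Real.pi) := by
  have h := integral_gaussian (1 / 2)
  rw [show Real.pi / (1 / 2) = 2 * Real.pi by ring] at h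
  rw [← h]
  congr 1
  ext u
  congr 1
  ring

lemma hasDerivAt_gaussLowerTail (t : ℝ) :
    HasDerivAt gaussLowerTail (Real.exp (-t ^ 2 / 2)) t := by
  have hc : Continuous fun u : ℝ => Real.exp (-u ^ 2 / 2) := by fun_prop
  have h1 : ∀ x, gaussLowerTail x = gaussLowerTail 0 + ∫ u in (0 : ℝ)..x, Real.exp (-u ^ 2 / 2) := by
    intro x
    have := intervalIntegral.integral_Iic_sub_Iic (a := (0 : ℝ)) (b := x)
      (integrable_exp_neg_sq_div_two.integrableOn) (integrable_exp_neg_sq_div_two.integrableOn)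
    unfold gaussLowerTail
    linarith
  rw [funext h1]
  exact (intervalIntegral.integral_hasDerivAt_right (hc.intervalIntegrable _ _)
    (hc.stronglyMeasurableAtFilter _ _) hc.continuousAt).const_add _

lemma gaussLowerTail_nonneg (t : ℝ) : 0 ≤ gaussLowerTail t :=
  integral_nonneg fun _ => (Real.exp_pos _).le

lemma exp_neg_sq_div_two_le_exp (t : ℝ) :
    Real.exp (-t ^ 2 / 2) ≤ Real.exp (1 / 2) * Real.exp t := by
  rw [← Real.exp_add]
  exact Real.exp_le_exp.2 (by nlinarith [sq_nonneg (t + 1)])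

lemma gaussLowerTail_le_exp (t : ℝ) : gaussLowerTail t ≤ Real.exp (1 / 2) * Real.exp t := by
  have hexp : ∫ u in Set.Iic t, Real.exp u = Real.exp t := integral_exp_Iic t
  rw [← hexp, ← integral_const_mul]
  exact integral_mono integrable_exp_neg_sq_div_two.integrableOn
    ((integrableOn_exp_Iic t).const_mul _) exp_neg_sq_div_two_le_exp

lemma gaussLowerTail_add_neg (t : ℝ) :
    gaussLowerTail t + gaussLowerTail (-t) = √(2 * Real.pi) := by
  have h : gaussLowerTail (-t) = ∫ u in Set.Ioi t, Real.exp (-u ^ 2 / 2) := by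
    unfold gaussLowerTail
    rw [← integral_comp_neg_Ioi]
    simp
  rw [h, ← integral_exp_neg_sq_div_two]
  have := intervalIntegral.integral_Iic_add_Ioi (b := t)
    (integrable_exp_neg_sq_div_two.integrableOn) (integrable_exp_neg_sq_div_two.integrableOn)
  exact this

lemma gaussLowerTail_zero : gaussLowerTail 0 = √(Real.pi / 2) := by
  have h := gaussLowerTail_add_neg 0
  have h2 : √(2 * Real.pi) = 2 * √(Real.pi / 2) := by
    rw [show 2 * Real.pi = 2 ^ 2 * (Real.pi / 2) by ring, Real.sqrt_mul (by norm_num),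
      Real.sqrt_sq (by norm_num)]
  rw [neg_zero, h2] at h
  linarith

lemma tendsto_gaussLowerTail_atTop : Tendsto gaussLowerTail atTop (𝓝 √(2 * Real.pi)) := by
  have h0 : Tendsto gaussLowerTail atBot (𝓝 0) := by
    refine squeeze_zero gaussLowerTail_nonneg gaussLowerTail_le_exp ?_
    simpa using Real.tendsto_exp_atBot.const_mul (Real.exp (1 / 2))
  have h1 := (h0.comp tendsto_neg_atTop_atBot).const_sub √(2 * Real.pi)
  rw [sub_zero] at h1
  refine h1.congr fun t => ?_
  have := gaussLowerTail_add_neg t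
  simp only [Function.comp]
  linarith

lemma tendsto_pow_mul_atBot_of_le_exp {f : ℝ → ℝ} {C : ℝ} (hf : ∀ t, 0 ≤ f t)
    (hfC : ∀ t, f t ≤ C * Real.exp t) (k : ℕ) :
    Tendsto (fun t => t ^ k * f t) atBot (𝓝 0) := by
  have h0 : Tendsto (fun t : ℝ => |t| ^ k * (C * Real.exp t)) atBot (𝓝 0) := by
    have := ((Real.tendsto_pow_mul_exp_neg_atTop_nhds_zero k).comp
      tendsto_neg_atBot_atTop).const_mul C
    rw [mul_zero] at this
    refine this.congr' ?_
    filter_upwards [eventually_le_atBot 0] with t ht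
    simp only [Function.comp, abs_of_nonpos ht, neg_neg]
    ring
  refine squeeze_zero_norm (fun t => ?_) h0
  rw [norm_mul, norm_pow, Real.norm_eq_abs, Real.norm_eq_abs, abs_of_nonneg (hf t)]
  exact mul_le_mul_of_nonneg_left (hfC t) (by positivity)

lemma tendsto_pow_mul_gaussLowerTail_atBot (k : ℕ) :
    Tendsto (fun t => t ^ k * gaussLowerTail t) atBot (𝓝 0) :=
  tendsto_pow_mul_atBot_of_le_exp gaussLowerTail_nonneg gaussLowerTail_le_exp k

lemma tendsto_pow_mul_exp_neg_sq_atBot (k : ℕ) :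
    Tendsto (fun t : ℝ => t ^ k * Real.exp (-t ^ 2 / 2)) atBot (𝓝 0) :=
  tendsto_pow_mul_atBot_of_le_exp (fun _ => (Real.exp_pos _).le) exp_neg_sq_div_two_le_exp k

/-- A function with nonnegative derivative that tends to `0` at `-∞` is nonnegative. -/
lemma nonneg_of_hasDerivAt_of_tendsto_atBot {f f' : ℝ → ℝ} (hf : ∀ t, HasDerivAt f (f' t) t)
    (hf' : ∀ t, 0 ≤ f' t) (h0 : Tendsto f atBot (𝓝 0)) (t : ℝ) : 0 ≤ f t :=
  (monotone_of_hasDerivAt_nonneg hf hf').le_of_tendsto h0 t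

/-- The function `t ↦ ∫_{-∞}^t (t - u) exp (-u² / 2) du`, integrated by parts: a primitive of
`gaussLowerTail`. -/
noncomputable def gaussLowerTailPrimitive (t : ℝ) : ℝ :=
  Real.exp (-t ^ 2 / 2) + t * gaussLowerTail t

lemma hasDerivAt_exp_neg_sq_div_two (t : ℝ) :
    HasDerivAt (fun t : ℝ => Real.exp (-t ^ 2 / 2)) (-t * Real.exp (-t ^ 2 / 2)) t := by
  have h : HasDerivAt (fun t : ℝ => -t ^ 2 / 2) (-t) t := by
    have := ((hasDerivAt_pow 2 t).fun_neg).div_const 2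
    refine this.congr_deriv ?_
    norm_num
    ring
  exact h.exp.congr_deriv (mul_comm _ _)

lemma hasDerivAt_gaussLowerTailPrimitive (t : ℝ) :
    HasDerivAt gaussLowerTailPrimitive (gaussLowerTail t) t := by
  have := (hasDerivAt_exp_neg_sq_div_two t).fun_add
    ((hasDerivAt_id' t).fun_mul (hasDerivAt_gaussLowerTail t))
  refine this.congr_deriv ?_
  simp

lemma tendsto_gaussLowerTailPrimitive_atBot : Tendsto gaussLowerTailPrimitive atBot (𝓝 0) := by
  have := (tendsto_pow_mul_exp_neg_sq_atBot 0).add (tendsto_pow_mul_gaussLowerTail_atBot 1)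
  simp only [pow_zero, one_mul, pow_one, add_zero] at this
  exact this

lemma gaussLowerTailPrimitive_nonneg (t : ℝ) : 0 ≤ gaussLowerTailPrimitive t :=
  nonneg_of_hasDerivAt_of_tendsto_atBot hasDerivAt_gaussLowerTailPrimitive gaussLowerTail_nonneg
    tendsto_gaussLowerTailPrimitive_atBot t

lemma gaussLowerTailPrimitive_pos (t : ℝ) : 0 < gaussLowerTailPrimitive t := by
  have hG : ∀ t, 0 < gaussLowerTail t := fun t => by
    have hm : StrictMono gaussLowerTail :=
      strictMono_of_hasDerivAt_pos hasDerivAt_gaussLowerTail fun t => Real.exp_pos _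
    exact (gaussLowerTail_nonneg (t - 1)).trans_lt (hm (by linarith))
  have hm : StrictMono gaussLowerTailPrimitive :=
    strictMono_of_hasDerivAt_pos hasDerivAt_gaussLowerTailPrimitive hG
  exact (gaussLowerTailPrimitive_nonneg (t - 1)).trans_lt (hm (by linarith))

/-- For `t = -x < 0` this is the bound `x / (1 + x²)` for the Mills ratio of the normal law. -/
lemma mills_lower_bound (t : ℝ) : 0 ≤ gaussLowerTail t + t * gaussLowerTailPrimitive t := by
  refine nonneg_of_hasDerivAt_of_tendsto_atBot (f' := fun t => 2 * gaussLowerTailPrimitive t)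
    (f := fun t => gaussLowerTail t + t * gaussLowerTailPrimitive t)
    (fun t => ?_) (fun t => mul_nonneg zero_le_two (gaussLowerTailPrimitive_nonneg t)) ?_ t
  · have := (hasDerivAt_gaussLowerTail t).fun_add
      ((hasDerivAt_id' t).fun_mul (hasDerivAt_gaussLowerTailPrimitive t))
    refine this.congr_deriv ?_
    simp only [gaussLowerTailPrimitive]
    ring
  · have := ((tendsto_pow_mul_gaussLowerTail_atBot 0).add
      (tendsto_pow_mul_gaussLowerTail_atBot 2)).add (tendsto_pow_mul_exp_neg_sq_atBot 1)
    simp only [add_zero] at this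
    refine this.congr fun t => ?_
    simp only [gaussLowerTailPrimitive]
    ring

/-- Log-concavity of `gaussLowerTailPrimitive`: with `H` this function, `H'' H ≤ H' ^ 2`. The
derivative of `H' ^ 2 - H'' H` is the quantity of `mills_lower_bound` times a positive factor. -/
lemma exp_mul_gaussLowerTailPrimitive_le_sq (t : ℝ) :
    Real.exp (-t ^ 2 / 2) * gaussLowerTailPrimitive t ≤ gaussLowerTail t ^ 2 := by
  rw [← sub_nonneg]
  refine nonneg_of_hasDerivAt_of_tendsto_atBot
    (f := fun t => gaussLowerTail t ^ 2 - Real.exp (-t ^ 2 / 2) * gaussLowerTailPrimitive t)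
    (f' := fun t => Real.exp (-t ^ 2 / 2) * (gaussLowerTail t + t * gaussLowerTailPrimitive t))
    (fun t => ?_) (fun t => mul_nonneg (Real.exp_pos _).le (mills_lower_bound t)) ?_ t
  · have := ((hasDerivAt_gaussLowerTail t).fun_pow 2).fun_sub
      ((hasDerivAt_exp_neg_sq_div_two t).fun_mul (hasDerivAt_gaussLowerTailPrimitive t))
    refine this.congr_deriv ?_
    norm_num
    ring
  · have := ((tendsto_pow_mul_gaussLowerTail_atBot 0).pow 2).sub
      ((tendsto_pow_mul_exp_neg_sq_atBot 0).mul tendsto_gaussLowerTailPrimitive_atBot)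
    simpa using this

/-- A log-concave function lies below the exponential of the tangent line of its logarithm, here at
the origin. -/
lemma gaussLowerTailPrimitive_le_exp (t : ℝ) :
    gaussLowerTailPrimitive t ≤ Real.exp (t * √(Real.pi / 2)) := by
  set c := √(Real.pi / 2)
  set q : ℝ → ℝ := fun t => gaussLowerTail t / gaussLowerTailPrimitive t with hq
  have hq0 : q 0 = c := by
    simp [hq, gaussLowerTailPrimitive, gaussLowerTail_zero, c]
  have hanti : Antitone q := by
    refine antitone_of_hasDerivAt_nonpos (f' := fun t =>
      (Real.exp (-t ^ 2 / 2) * gaussLowerTailPrimitive t - gaussLowerTail t * gaussLowerTail t) /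
        gaussLowerTailPrimitive t ^ 2) (fun t => ?_) fun t => ?_
    · exact (hasDerivAt_gaussLowerTail t).div (hasDerivAt_gaussLowerTailPrimitive t)
        (gaussLowerTailPrimitive_pos t).ne'
    · refine div_nonpos_of_nonpos_of_nonneg ?_ (sq_nonneg _)
      have := exp_mul_gaussLowerTailPrimitive_le_sq t
      nlinarith
  set k : ℝ → ℝ := fun t => Real.log (gaussLowerTailPrimitive t) - t * c with hk
  have hk' : ∀ t, HasDerivAt k (q t - c) t := fun t => by
    have := ((hasDerivAt_gaussLowerTailPrimitive t).log (gaussLowerTailPrimitive_pos t).ne').fun_sub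
      ((hasDerivAt_id' t).mul_const c)
    simpa [hk, hq] using this
  have hkc : Continuous k := continuous_iff_continuousAt.2 fun t => (hk' t).continuousAt
  have hk0 : k 0 = 0 := by simp [hk, gaussLowerTailPrimitive]
  have hkle : k t ≤ 0 := by
    rcases le_total 0 t with h | h
    · have hanti' : AntitoneOn k (Set.Ici 0) := by
        refine antitoneOn_of_hasDerivWithinAt_nonpos (convex_Ici 0) hkc.continuousOn
          (fun x _ => (hk' x).hasDerivWithinAt) fun x hx => ?_
        rw [interior_Ici] at hx
        have := hanti (le_of_lt hx)
        linarith
      have := hanti' (Set.self_mem_Ici) h h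
      linarith
    · have hmono' : MonotoneOn k (Set.Iic 0) := by
        refine monotoneOn_of_hasDerivWithinAt_nonneg (convex_Iic 0) hkc.continuousOn
          (fun x _ => (hk' x).hasDerivWithinAt) fun x hx => ?_
        rw [interior_Iic] at hx
        have := hanti (le_of_lt hx)
        linarith
      have := hmono' h (Set.self_mem_Iic) h
      linarith
  rw [← Real.log_le_iff_le_exp (gaussLowerTailPrimitive_pos t)]
  simp only [hk] at hkle
  linarith

/-! ### The Rayleigh law -/

instance isProbabilityMeasure_complexNormal (z : ℂ) (v : ℝ≥0) :
    IsProbabilityMeasure (complexNormal z v) :=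
  Measure.isProbabilityMeasure_map (MeasurableEquiv.measurable _).aemeasurable

lemma norm_measurableEquivRealProd_symm (p : ℝ × ℝ) :
    ‖Complex.measurableEquivRealProd.symm p‖ = √(p.1 ^ 2 + p.2 ^ 2) := by
  rw [Complex.norm_eq_sqrt_sq_add_sq]
  rfl

lemma gaussianPDF_mul_gaussianPDF (x y : ℝ) :
    gaussianPDF 0 1 x * gaussianPDF 0 1 y =
      ENNReal.ofReal ((2 * Real.pi)⁻¹ * Real.exp (-(x ^ 2 + y ^ 2) / 2)) := by
  rw [gaussianPDF, gaussianPDF, ← ENNReal.ofReal_mul (gaussianPDFReal_nonneg _ _ _)]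
  congr 1
  have h : √(2 * Real.pi) * √(2 * Real.pi) = 2 * Real.pi := Real.mul_self_sqrt (by positivity)
  simp only [gaussianPDFReal, NNReal.coe_one, mul_one, sub_zero]
  rw [mul_mul_mul_comm, ← mul_inv, h, ← Real.exp_add]
  congr 2
  ring

/-- The modulus of a complex normal variable of total variance `2` has the Rayleigh density
`r exp (-r² / 2)` on the positive half-line. -/
lemma lintegral_norm_complexNormal_zero_two {f : ℝ → ENNReal} (hf : Measurable f) :
    ∫⁻ z, f ‖z‖ ∂complexNormal 0 2 =
      ∫⁻ r in Set.Ioi (0 : ℝ), ENNReal.ofReal (r * Real.exp (-r ^ 2 / 2)) * f r := by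
  have h22 : (2 : ℝ≥0) / 2 = 1 := by norm_num
  rw [complexNormal, lintegral_map_equiv, h22, Complex.zero_re, Complex.zero_im,
    gaussianReal_of_var_ne_zero _ one_ne_zero,
    prod_withDensity (measurable_gaussianPDF _ _) (measurable_gaussianPDF _ _),
    lintegral_withDensity_eq_lintegral_mul _ (by fun_prop) (by fun_prop), ← Measure.volume_eq_prod,
    ← lintegral_comp_polarCoord_symm]
  have h1 : ∀ p ∈ polarCoord.target,
      ENNReal.ofReal p.1 • ((fun z : ℝ × ℝ => gaussianPDF 0 1 z.1 * gaussianPDF 0 1 z.2) *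
        fun a => f ‖Complex.measurableEquivRealProd.symm a‖) (polarCoord.symm p) =
      (ENNReal.ofReal (p.1 * Real.exp (-p.1 ^ 2 / 2)) * f p.1) *
        ENNReal.ofReal (2 * Real.pi)⁻¹ := by
    intro p hp
    have hp1 : 0 < p.1 := hp.1
    have h2 : (polarCoord.symm p).1 ^ 2 + (polarCoord.symm p).2 ^ 2 = p.1 ^ 2 := by
      rw [polarCoord_symm_apply]
      have := Real.cos_sq_add_sin_sq p.2
      simp only
      linear_combination p.1 ^ 2 * this
    rw [Pi.mul_apply, norm_measurableEquivRealProd_symm, gaussianPDF_mul_gaussianPDF, h2,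
      Real.sqrt_sq hp1.le, smul_eq_mul, ENNReal.ofReal_mul (by positivity),
      ENNReal.ofReal_mul hp1.le]
    ring
  rw [setLIntegral_congr_fun polarCoord.open_target.measurableSet h1, polarCoord_target,
    Measure.volume_eq_prod, ← Measure.prod_restrict,
    lintegral_prod_mul (μ := volume.restrict (Set.Ioi (0 : ℝ)))
      (ν := volume.restrict (Set.Ioo (-Real.pi) Real.pi))
      (f := fun r => ENNReal.ofReal (r * Real.exp (-r ^ 2 / 2)) * f r)
      (g := fun _ => ENNReal.ofReal (2 * Real.pi)⁻¹) (by fun_prop) (by fun_prop),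
    lintegral_const, Measure.restrict_apply_univ, Real.volume_Ioo,
    ← ENNReal.ofReal_mul (by positivity), show (2 * Real.pi)⁻¹ * (Real.pi - -Real.pi) = 1 by
      rw [sub_neg_eq_add, ← two_mul, inv_mul_cancel₀ (by positivity)], ENNReal.ofReal_one, mul_one]

lemma map_norm_complexNormal_zero_two :
    (complexNormal 0 2).map (fun z => ‖z‖) =
      (volume.restrict (Set.Ioi (0 : ℝ))).withDensity
        fun r => ENNReal.ofReal (r * Real.exp (-r ^ 2 / 2)) := by
  refine Measure.ext_of_lintegral _ fun f hf => ?_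
  rw [lintegral_map hf (by fun_prop), lintegral_norm_complexNormal_zero_two hf,
    lintegral_withDensity_eq_lintegral_mul _ (by fun_prop) hf]
  rfl

/-- A primitive of the exponentially tilted Rayleigh density. -/
lemma hasDerivAt_primitive_tilted_rayleigh (t r : ℝ) :
    HasDerivAt (fun r => Real.exp (t ^ 2 / 2) *
        (t * gaussLowerTail (r - t) - Real.exp (-(r - t) ^ 2 / 2)))
      (r * Real.exp (-r ^ 2 / 2) * Real.exp (t * r)) r := by
  have h1 := ((hasDerivAt_gaussLowerTail (r - t)).comp_sub_const r t).const_mul t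
  have h2 := (hasDerivAt_exp_neg_sq_div_two (r - t)).comp_sub_const r t
  refine ((h1.fun_sub h2).const_mul (Real.exp (t ^ 2 / 2))).congr_deriv ?_
  have h3 : Real.exp (-r ^ 2 / 2) * Real.exp (t * r) =
      Real.exp (t ^ 2 / 2) * Real.exp (-(r - t) ^ 2 / 2) := by
    rw [← Real.exp_add, ← Real.exp_add]
    congr 1
    ring
  rw [mul_assoc, h3]
  ring

lemma tendsto_primitive_tilted_rayleigh (t : ℝ) :
    Tendsto (fun r => Real.exp (t ^ 2 / 2) *
        (t * gaussLowerTail (r - t) - Real.exp (-(r - t) ^ 2 / 2))) atTop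
      (𝓝 (Real.exp (t ^ 2 / 2) * (t * √(2 * Real.pi)))) := by
  have hs : Tendsto (fun r : ℝ => r - t) atTop atTop := tendsto_atTop_add_const_right _ _ tendsto_id
  have h1 := (tendsto_gaussLowerTail_atTop.comp hs).const_mul t
  have h2 : Tendsto (fun r : ℝ => Real.exp (-r ^ 2 / 2)) atTop (𝓝 0) := by
    have := (tendsto_pow_mul_exp_neg_sq_atBot 0).comp tendsto_neg_atTop_atBot
    refine this.congr fun r => ?_
    simp
  have := (h1.sub (h2.comp hs)).const_mul (Real.exp (t ^ 2 / 2))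
  rw [sub_zero] at this
  exact this

lemma integral_tilted_rayleigh (t : ℝ) :
    ∫ r in Set.Ioi (0 : ℝ), r * Real.exp (-r ^ 2 / 2) * Real.exp (t * r) =
      Real.exp (t ^ 2 / 2) * gaussLowerTailPrimitive t := by
  rw [integral_Ioi_of_hasDerivAt_of_nonneg'
    (fun r _ => hasDerivAt_primitive_tilted_rayleigh t r)
    (fun r hr => by have : 0 < r := hr; positivity) (tendsto_primitive_tilted_rayleigh t),
    gaussLowerTailPrimitive, ← gaussLowerTail_add_neg t, zero_sub, neg_sq]
  ring

lemma integrableOn_tilted_rayleigh (t : ℝ) :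
    IntegrableOn (fun r => r * Real.exp (-r ^ 2 / 2) * Real.exp (t * r)) (Set.Ioi (0 : ℝ)) :=
  integrableOn_Ioi_deriv_of_nonneg'
    (fun r _ => hasDerivAt_primitive_tilted_rayleigh t r)
    (fun r hr => by have : 0 < r := hr; positivity) (tendsto_primitive_tilted_rayleigh t)

lemma integrable_exp_mul_norm_complexNormal (t : ℝ) :
    Integrable (fun z => Real.exp (t * ‖z‖)) (complexNormal 0 2) := by
  have h : Integrable (fun r => Real.exp (t * r)) ((complexNormal 0 2).map (fun z => ‖z‖)) := by
    rw [map_norm_complexNormal_zero_two,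
      integrable_withDensity_iff_integrable_smul' (by fun_prop) (by simp)]
    refine (integrableOn_tilted_rayleigh t).congr_fun (fun r hr => ?_) measurableSet_Ioi
    have : 0 < r := hr
    simp only [smul_eq_mul]
    rw [ENNReal.toReal_ofReal (by positivity)]
  exact h.comp_measurable (by fun_prop)

lemma mgf_norm_complexNormal_zero_two (t : ℝ) :
    mgf (fun z => ‖z‖) (complexNormal 0 2) t = Real.exp (t ^ 2 / 2) * gaussLowerTailPrimitive t := by
  rw [← mgf_id_map (by fun_prop), mgf, map_norm_complexNormal_zero_two,
    integral_withDensity_eq_integral_toReal_smul (by fun_prop) (by simp),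
    ← integral_tilted_rayleigh]
  refine setIntegral_congr_fun measurableSet_Ioi fun r hr => ?_
  have : 0 < r := hr
  simp only [smul_eq_mul, id]
  rw [ENNReal.toReal_ofReal (by positivity)]

/-- The Rayleigh law is sub-Gaussian around its mean `√(π / 2)`, with the variance proxy `1` of the
underlying real normal variables. -/
lemma hasSubgaussianMGF_norm_complexNormal_zero_two :
    HasSubgaussianMGF (fun z : ℂ => ‖z‖ - √(Real.pi / 2)) 1 (complexNormal 0 2) where
  integrable_exp_mul t := by
    refine ((integrable_exp_mul_norm_complexNormal t).mul_const
      (Real.exp (-(t * √(Real.pi / 2))))).congr (ae_of_all _ fun z => ?_)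
    simp only
    rw [← Real.exp_add]
    congr 1
    ring
  mgf_le t := by
    simp_rw [sub_eq_add_neg]
    rw [mgf_add_const, mul_neg, mgf_norm_complexNormal_zero_two, mul_assoc, NNReal.coe_one, one_mul]
    refine mul_le_of_le_one_right (Real.exp_pos _).le ?_
    calc gaussLowerTailPrimitive t * Real.exp (-(t * √(Real.pi / 2)))
        ≤ Real.exp (t * √(Real.pi / 2)) * Real.exp (-(t * √(Real.pi / 2))) := by
          gcongr
          exact gaussLowerTailPrimitive_le_exp t
      _ = 1 := by rw [← Real.exp_add, add_neg_cancel, Real.exp_zero]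

/-! ### Linear combinations of complex normal variables -/

lemma charFun_complexNormal_zero (v : ℝ≥0) (t : ℂ) :
    charFun (complexNormal 0 v) t = Complex.exp (-(v * ‖t‖ ^ 2 / 4 : ℝ)) := by
  have h1 : charFun (complexNormal 0 v) t =
      charFun (gaussianReal 0 (v / 2)) t.re * charFun (gaussianReal 0 (v / 2)) t.im := by
    rw [charFun_apply, charFun_apply, charFun_apply, ← integral_prod_mul, complexNormal,
      integral_map_equiv]
    refine integral_congr_ae (ae_of_all _ fun p => ?_)
    have h : inner ℝ (Complex.measurableEquivRealProd.symm p) t = p.1 * t.re + p.2 * t.im := by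
      rw [Complex.inner]
      simp [Complex.measurableEquivRealProd, mul_comm]
    simp only
    rw [h, ← Complex.exp_add]
    congr 1
    simp
    ring
  have h2 : (‖t‖ ^ 2 : ℝ) = t.re ^ 2 + t.im ^ 2 := by
    rw [Complex.sq_norm, Complex.normSq_apply]
    ring
  rw [h1, charFun_gaussianReal, charFun_gaussianReal, ← Complex.exp_add, h2]
  congr 1
  push_cast
  ring

lemma charFun_map_mul_const {μ : Measure ℂ} (c t : ℂ) :
    charFun (μ.map (fun z => z * c)) t = charFun μ (t * (starRingEnd ℂ) c) := by
  rw [charFun_apply, charFun_apply, integral_map (by fun_prop) (by fun_prop)]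
  congr 1
  ext z
  congr 3
  simp only [Complex.inner, map_mul]
  ring_nf

lemma map_const_mul_complexNormal {a : ℝ} {v w : ℝ≥0} (h : (w : ℝ) = a ^ 2 * v) :
    (complexNormal 0 v).map (fun z => z * (a : ℂ)) = complexNormal 0 w := by
  have : IsProbabilityMeasure ((complexNormal 0 v).map (fun z => z * (a : ℂ))) :=
    Measure.isProbabilityMeasure_map (by fun_prop)
  refine Measure.ext_of_charFun (funext fun t => ?_)
  rw [charFun_map_mul_const, charFun_complexNormal_zero, charFun_complexNormal_zero]
  congr 3
  rw [norm_mul, RCLike.norm_conj, Complex.norm_real, Real.norm_eq_abs, mul_pow, sq_abs, h]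
  ring

/-- Unitary invariance: a combination of independent centred complex normal variables whose
coefficients form a unit vector has again their common law. -/
lemma hasLaw_sum_mul_complexNormal {Ω ι : Type*} [MeasurableSpace Ω] {P : Measure Ω} [Fintype ι]
    {v : ℝ≥0} {X : ι → Ω → ℂ} (hlaw : ∀ i, HasLaw (X i) (complexNormal 0 v) P)
    (hind : iIndepFun X P) (x : EuclideanSpace ℂ ι) (hx : ‖x‖ = 1) :
    HasLaw (fun ω => ∑ i, X i ω * x i) (complexNormal 0 v) P := by
  have := hind.isProbabilityMeasure
  have hX : ∀ i, AEMeasurable (X i) P := fun i => (hlaw i).aemeasurable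
  have hm : AEMeasurable (fun ω => ∑ i, X i ω * x i) P := by fun_prop
  refine ⟨hm, ?_⟩
  have : IsProbabilityMeasure (P.map (fun ω => ∑ i, X i ω * x i)) :=
    Measure.isProbabilityMeasure_map hm
  refine Measure.ext_of_charFun (funext fun t => ?_)
  have hind' : iIndepFun (fun i ω => X i ω * x i) P :=
    hind.comp (fun i z => z * x i) fun i => by fun_prop
  rw [hind'.charFun_map_fun_sum_eq_prod (fun i => by fun_prop), Finset.prod_apply]
  have h1 : ∀ i, charFun (P.map (fun ω => X i ω * x i)) t =
      Complex.exp (-(v * ‖t‖ ^ 2 / 4 : ℝ) * (‖x i‖ ^ 2 : ℝ)) := by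
    intro i
    have h2 : P.map (fun ω => X i ω * x i) = (complexNormal 0 v).map (fun z => z * x i) := by
      rw [← (hlaw i).map_eq, AEMeasurable.map_map_of_aemeasurable (by fun_prop) (hX i)]
      rfl
    rw [h2, charFun_map_mul_const, charFun_complexNormal_zero, norm_mul, RCLike.norm_conj]
    congr 1
    push_cast
    ring
  simp_rw [h1]
  rw [← Complex.exp_sum, ← Finset.mul_sum, ← Complex.ofReal_sum, ← EuclideanSpace.norm_sq_eq, hx,
    charFun_complexNormal_zero]
  simp

/-! ### Concentration for a fixed vector -/

lemma hasSubgaussianMGF_norm_complexNormal {a : ℝ} (ha : 0 ≤ a) {v : ℝ≥0}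
    (hv : (v : ℝ) = 2 * a ^ 2) :
    HasSubgaussianMGF (fun z : ℂ => ‖z‖ - a * √(Real.pi / 2)) (a ^ 2).toNNReal
      (complexNormal 0 v) := by
  have hmap : (complexNormal 0 2).map (fun z => z * (a : ℂ)) = complexNormal 0 v :=
    map_const_mul_complexNormal (by rw [hv]; push_cast; ring)
  have hm : Measurable (fun z : ℂ => z * (a : ℂ)) := by fun_prop
  rw [← HasSubgaussianMGF.id_map_iff (by fun_prop), ← hmap, Measure.map_map (by fun_prop) hm,
    HasSubgaussianMGF.id_map_iff (by fun_prop)]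
  have h := hasSubgaussianMGF_norm_complexNormal_zero_two.const_mul a
  convert h using 1
  · ext z
    simp only [Function.comp, norm_mul, Complex.norm_real, Real.norm_eq_abs, abs_of_nonneg ha]
    ring
  · exact (Real.toNNReal_of_nonneg (sq_nonneg a)).trans (mul_one _).symm

/-- The rows of a matrix with independent entries are independent. -/
lemma iIndepFun_rows {Ω ι κ E : Type*} [MeasurableSpace Ω] [MeasurableSpace E] {P : Measure Ω}
    [Fintype ι] [Fintype κ] {X : ι → κ → Ω → E} (hX : ∀ i j, AEMeasurable (X i j) P)
    (h : iIndepFun (fun (p : ι × κ) => X p.1 p.2) P) : iIndepFun (fun i ω j => X i j ω) P := by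
  have := h.isProbabilityMeasure
  have hprob : ∀ i j, IsProbabilityMeasure (P.map (X i j)) :=
    fun i j => Measure.isProbabilityMeasure_map (hX i j)
  rw [iIndepFun_iff_map_fun_eq_pi_map fun i => aemeasurable_pi_lambda _ (hX i)]
  have hrow : ∀ i, P.map (fun ω j => X i j ω) = Measure.infinitePi fun j => P.map (X i j) := by
    intro i
    rw [Measure.infinitePi_eq_pi]
    exact (h.precomp (Prod.mk_right_injective i)).map_fun_eq_pi_map (hX i)
  have hjoint := h.map_fun_eq_pi_map fun p : ι × κ => hX p.1 p.2
  simp_rw [hrow]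
  rw [← Measure.infinitePi_eq_pi, ← Measure.infinitePi_map_curry (fun i j => P.map (X i j)),
    Measure.infinitePi_eq_pi, ← hjoint, AEMeasurable.map_map_of_aemeasurable
      (MeasurableEquiv.measurable _).aemeasurable
      (aemeasurable_pi_lambda _ fun p : ι × κ => hX p.1 p.2)]
  rfl

/-- Concentration of `‖Φ x‖₁` around its mean `1`, for a fixed unit vector `x`. -/
lemma measureReal_abs_norm_mulVec_sub_one_ge_le {Ω : Type*} [MeasurableSpace Ω] {P : Measure Ω}
    [IsProbabilityMeasure P] {m n : ℕ} (hm : 0 < m) {σ : ℝ}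
    (hσ : σ = 1 / (m : ℝ) * (√2 / √Real.pi)) {Φ : Ω → Matrix (Fin m) (Fin n) ℂ}
    (hΦ : IsComplexGaussianMatrix P 0 (2 * σ ^ 2).toNNReal Φ) (x : EuclideanSpace ℂ (Fin n))
    (hx : ‖x‖ = 1) {t : ℝ} (ht : 0 ≤ t) :
    P.real {ω | t ≤ |‖WithLp.toLp 1 (Φ ω *ᵥ x.ofLp)‖ - 1|} ≤
      2 * Real.exp (-(Real.pi * m * t ^ 2 / 4)) := by
  have hm' : (0 : ℝ) < m := by exact_mod_cast hm
  have hpi := Real.pi_pos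
  have hσ0 : 0 ≤ σ := by rw [hσ]; positivity
  have hσ2 : σ ^ 2 = 2 / (Real.pi * m ^ 2) := by
    rw [hσ, mul_pow, div_pow, div_pow, Real.sq_sqrt zero_le_two, Real.sq_sqrt hpi.le]
    field_simp
  have hmean : σ * √(Real.pi / 2) = 1 / m := by
    rw [hσ, Real.sqrt_div hpi.le]
    field_simp
  have hae : ∀ i j, AEMeasurable (fun ω => Φ ω i j) P := fun i j => (hΦ.hasLaw i j).aemeasurable
  -- the coordinates of `Φ x`, their law and their independence
  set Y : Fin m → Ω → ℂ := fun i ω => ∑ j, Φ ω i j * x j with hY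
  have hYlaw : ∀ i, HasLaw (Y i) (complexNormal 0 (2 * σ ^ 2).toNNReal) P := fun i =>
    hasLaw_sum_mul_complexNormal (hΦ.hasLaw i) (hΦ.indep.precomp (Prod.mk_right_injective i)) x hx
  have hYind : iIndepFun Y P :=
    (iIndepFun_rows (X := fun i j ω => Φ ω i j) hae hΦ.indep).comp
      (fun _ r => ∑ j, r j * x j) fun _ => by fun_prop
  set Z : Fin m → Ω → ℝ := fun i ω => ‖Y i ω‖ - σ * √(Real.pi / 2) with hZ
  have hZind : iIndepFun Z P :=
    hYind.comp (fun _ z => ‖z‖ - σ * √(Real.pi / 2)) fun _ => by fun_prop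
  have hZsub : ∀ i ∈ Finset.univ, HasSubgaussianMGF (Z i) (σ ^ 2).toNNReal P := by
    intro i _
    refine HasSubgaussianMGF.of_map (Y := Y i) (X := fun z : ℂ => ‖z‖ - σ * √(Real.pi / 2))
      (hYlaw i).aemeasurable ?_
    rw [(hYlaw i).map_eq]
    exact hasSubgaussianMGF_norm_complexNormal hσ0 (Real.coe_toNNReal _ (by positivity))
  have hsum := HasSubgaussianMGF.sum_of_iIndepFun hZind hZsub
  have hSZ : ∀ ω, ‖WithLp.toLp 1 (Φ ω *ᵥ x.ofLp)‖ - 1 = ∑ i, Z i ω := by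
    intro ω
    rw [PiLp.norm_eq_of_L1]
    simp only [hZ, hmean, Finset.sum_sub_distrib, Finset.sum_const, Finset.card_univ,
      Fintype.card_fin, nsmul_eq_mul]
    rw [mul_one_div_cancel hm'.ne']
    rfl
  have hexp : -t ^ 2 / (2 * ((∑ _i : Fin m, (σ ^ 2).toNNReal : ℝ≥0) : ℝ)) =
      -(Real.pi * m * t ^ 2 / 4) := by
    rw [Finset.sum_const, Finset.card_univ, Fintype.card_fin, nsmul_eq_mul, NNReal.coe_mul,
      NNReal.coe_natCast, Real.coe_toNNReal _ (sq_nonneg σ), hσ2]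
    field_simp
    norm_num
  have hup := hsum.measure_ge_le ht
  have hdown := hsum.neg.measure_ge_le ht
  rw [hexp] at hup hdown
  calc P.real {ω | t ≤ |‖WithLp.toLp 1 (Φ ω *ᵥ x.ofLp)‖ - 1|}
      ≤ P.real ({ω | t ≤ ∑ i, Z i ω} ∪ {ω | t ≤ (-fun ω => ∑ i, Z i ω) ω}) := by
        refine measureReal_mono fun ω hω => ?_
        simp only [Set.mem_ofPred_eq, hSZ, le_abs] at hω
        exact hω
    _ ≤ _ := measureReal_union_le _ _
    _ ≤ _ := by linarith

/-! ### Nets of unit spheres -/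

/-- The volume bound for the cardinality of a separated family of unit vectors: the balls of radius
`ρ / 2` around them are disjoint and contained in the ball of radius `1 + ρ / 2`. -/
lemma card_le_of_separated_of_norm_eq_one {E : Type*} [NormedAddCommGroup E] [NormedSpace ℝ E]
    [FiniteDimensional ℝ E] {ρ : ℝ} (hρ : 0 < ρ) (s : Finset E) (hs : ∀ c ∈ s, ‖c‖ = 1)
    (h : ∀ c ∈ s, ∀ d ∈ s, c ≠ d → ρ ≤ ‖c - d‖) :
    (s.card : ℝ) ≤ (1 + 2 / ρ) ^ Module.finrank ℝ E := by
  borelize E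
  let μ : Measure E := Measure.addHaar
  have hρ2 : 0 < ρ / 2 := by positivity
  have hR : 0 < 1 + ρ / 2 := by positivity
  have hdisj : Set.Pairwise (s : Set E) (Function.onFun Disjoint fun c => Metric.ball c (ρ / 2)) := by
    intro c hc d hd hcd
    apply Metric.ball_disjoint_ball
    rw [dist_eq_norm, add_halves]
    exact h c hc d hd hcd
  have hsub : (⋃ c ∈ s, Metric.ball c (ρ / 2)) ⊆ Metric.ball (0 : E) (1 + ρ / 2) := by
    refine Set.iUnion₂_subset fun x hx => Metric.ball_subset_ball' ?_
    rw [dist_zero_right, hs x hx, add_comm]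
  have hvol : ((s.card : ENNReal) * ENNReal.ofReal ((ρ / 2) ^ Module.finrank ℝ E)) *
      μ (Metric.ball 0 1) ≤
      ENNReal.ofReal ((1 + ρ / 2) ^ Module.finrank ℝ E) * μ (Metric.ball 0 1) := by
    have := measure_mono (μ := μ) hsub
    rw [measure_biUnion_finset hdisj fun c _ => measurableSet_ball] at this
    simp only [μ.addHaar_ball_of_pos _ hρ2, μ.addHaar_ball_of_pos _ hR, Finset.sum_const,
      nsmul_eq_mul, ← mul_assoc] at this
    exact this
  have hcard := (ENNReal.mul_le_mul_iff_left (Metric.measure_ball_pos _ _ zero_lt_one).ne'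
    measure_ball_lt_top.ne).1 hvol
  have hreal := ENNReal.toReal_le_of_le_ofReal (by positivity) hcard
  rw [ENNReal.toReal_mul, ENNReal.toReal_natCast, ENNReal.toReal_ofReal (by positivity),
    ← le_div_iff₀ (by positivity), ← div_pow] at hreal
  have hratio : (1 + ρ / 2) / (ρ / 2) = 1 + 2 / ρ := by
    field_simp
    ring
  rwa [hratio] at hreal

/-- A separated family of unit vectors of maximal cardinality is a net of the unit sphere. -/
lemma exists_net_unit_sphere (E : Type*) [NormedAddCommGroup E] [NormedSpace ℝ E]
    [FiniteDimensional ℝ E] {ρ : ℝ} (hρ : 0 < ρ) :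
    ∃ N : Finset E, (∀ q ∈ N, ‖q‖ = 1) ∧ (∀ x : E, ‖x‖ = 1 → ∃ q ∈ N, ‖x - q‖ ≤ ρ) ∧
      (N.card : ℝ) ≤ (1 + 2 / ρ) ^ Module.finrank ℝ E := by
  classical
  let p : Finset E → Prop := fun s =>
    (∀ c ∈ s, ‖c‖ = 1) ∧ ∀ c ∈ s, ∀ d ∈ s, c ≠ d → ρ ≤ ‖c - d‖
  have hfin : {k | ∃ s, p s ∧ s.card = k}.Finite := by
    refine (Set.finite_Iic ⌊(1 + 2 / ρ) ^ Module.finrank ℝ E⌋₊).subset ?_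
    rintro _ ⟨s, hs, rfl⟩
    exact Nat.le_floor (card_le_of_separated_of_norm_eq_one hρ s hs.1 hs.2)
  obtain ⟨_, ⟨N, hN, rfl⟩, hmax⟩ := hfin.exists_maximal ⟨0, ∅, by simp [p]⟩
  refine ⟨N, hN.1, fun x hx => ?_, card_le_of_separated_of_norm_eq_one hρ N hN.1 hN.2⟩
  by_contra! hcon
  have hxN : x ∉ N := fun hxN => by
    have := hcon x hxN
    rw [sub_self, norm_zero] at this
    exact absurd this hρ.le.not_gt
  have hins : p (insert x N) := by
    refine ⟨fun c hc => ?_, fun c hc d hd hcd => ?_⟩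
    · rcases Finset.mem_insert.1 hc with rfl | hc
      exacts [hx, hN.1 c hc]
    · rcases Finset.mem_insert.1 hc with hcx | hcN <;>
        rcases Finset.mem_insert.1 hd with hdx | hdN
      · exact absurd (hcx.trans hdx.symm) hcd
      · rw [hcx]
        exact (hcon d hdN).le
      · rw [hdx, norm_sub_rev]
        exact (hcon c hcN).le
      · exact hN.2 c hcN d hdN hcd
  have := hmax ⟨_, hins, rfl⟩ (by rw [Finset.card_insert_of_notMem hxN]; exact Nat.le_succ _)
  rw [Finset.card_insert_of_notMem hxN] at this
  omega

/-- An operator that is nearly isometric on a `δ / 3`-net of the unit sphere is nearly isometric: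
its norm satisfies `‖T‖ ≤ 1 + δ / 3 + ‖T‖ * δ / 3`, hence `‖T‖ ≤ 1 + δ`. -/
lemma norm_bounds_of_net {E F : Type*} [NormedAddCommGroup E] [NormedSpace ℝ E]
    [NormedAddCommGroup F] [NormedSpace ℝ F] (T : E →L[ℝ] F) {δ : ℝ} (hδ0 : 0 < δ) (hδ1 : δ < 1)
    {N : Finset E} (hnet : ∀ x : E, ‖x‖ = 1 → ∃ q ∈ N, ‖x - q‖ ≤ δ / 3)
    (hN : ∀ q ∈ N, |‖T q‖ - 1| ≤ δ / 3) (x : E) :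
    (1 - δ) * ‖x‖ ≤ ‖T x‖ ∧ ‖T x‖ ≤ (1 + δ) * ‖x‖ := by
  have hT0 := norm_nonneg T
  have hdiff : ∀ y : E, ‖y‖ = 1 → |‖T y‖ - 1| ≤ δ / 3 + ‖T‖ * (δ / 3) := by
    intro y hy
    obtain ⟨q, hq, hyq⟩ := hnet y hy
    have h1 : |‖T y‖ - ‖T q‖| ≤ ‖T‖ * (δ / 3) := by
      refine (abs_norm_sub_norm_le _ _).trans ?_
      rw [← map_sub]
      exact (T.le_opNorm _).trans (mul_le_mul_of_nonneg_left hyq hT0)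
    have h2 := abs_sub_le ‖T y‖ ‖T q‖ 1
    have h3 := hN q hq
    linarith
  have hTle : ‖T‖ ≤ 1 + δ := by
    have h : ‖T‖ ≤ 1 + (δ / 3 + ‖T‖ * (δ / 3)) := by
      refine T.opNorm_le_of_unit_norm (by positivity) fun y hy => ?_
      linarith [(abs_le.1 (hdiff y hy)).2]
    nlinarith
  refine ⟨?_, (T.le_opNorm x).trans (mul_le_mul_of_nonneg_right hTle (norm_nonneg x))⟩
  rcases eq_or_ne x 0 with rfl | hx
  · simp
  have hx0 : 0 < ‖x‖ := norm_pos_iff.2 hx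
  have hunit : ‖(‖x‖⁻¹ : ℝ) • x‖ = 1 := norm_smul_inv_norm hx
  have h := (abs_le.1 (hdiff _ hunit)).1
  rw [map_smul, norm_smul, norm_inv, norm_norm] at h
  have h' : 1 - δ ≤ ‖x‖⁻¹ * ‖T x‖ := by nlinarith
  rwa [inv_mul_eq_div, le_div_iff₀ hx0] at h'

/-! ### Sparse vectors -/

/-- The vectors of `ℂⁿ` supported in `S`, with the Euclidean norm. -/
def supportedOn {n : ℕ} (S : Finset (Fin n)) : Submodule ℂ (EuclideanSpace ℂ (Fin n)) where
  carrier := {x | ∀ j ∉ S, x j = 0}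
  add_mem' hx hy j hj := by simp [hx j hj, hy j hj]
  zero_mem' j _ := by simp
  smul_mem' c x hx j hj := by simp [hx j hj]

lemma finrank_real_supportedOn_le {n : ℕ} (S : Finset (Fin n)) :
    Module.finrank ℝ (supportedOn S) ≤ 2 * S.card := by
  rw [finrank_real_of_complex]
  refine Nat.mul_le_mul_left 2 ?_
  let r : supportedOn S →ₗ[ℂ] (S → ℂ) :=
    { toFun := fun x j => x.1 j
      map_add' := fun _ _ => rfl
      map_smul' := fun _ _ => rfl }
  have hr : Function.Injective r := by
    intro x y hxy
    ext j
    by_cases hj : j ∈ S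
    · exact congrFun hxy ⟨j, hj⟩
    · rw [x.2 j hj, y.2 j hj]
  simpa using LinearMap.finrank_le_finrank_of_injective hr

/-- The operator `x ↦ A x` from the Euclidean space `supportedOn S` to `ℓ₁`. -/
noncomputable def mulVecSupported {m n : ℕ} (A : Matrix (Fin m) (Fin n) ℂ) (S : Finset (Fin n)) :
    supportedOn S →L[ℝ] PiLp 1 (fun _ : Fin m => ℂ) :=
  LinearMap.toContinuousLinearMap
    { toFun := fun x => WithLp.toLp 1 (A *ᵥ x.1.ofLp)
      map_add' := fun x y => by simp [Matrix.mulVec_add]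
      map_smul' := fun c x => by
        have h : ((c • x : supportedOn S) : EuclideanSpace ℂ (Fin n)).ofLp = c • x.1.ofLp := rfl
        rw [h, Matrix.mulVec_smul]
        rfl }

/-- The restricted isometry property follows from near-isometry on nets of the unit spheres of all
coordinate subspaces of dimension `s`. -/
lemma satisfiesRIP_of_net {m n s : ℕ} (hsn : s ≤ n) (A : Matrix (Fin m) (Fin n) ℂ) {δ : ℝ}
    (hδ0 : 0 < δ) (hδ1 : δ < 1) (N : (S : Finset (Fin n)) → Finset (supportedOn S))
    (hnet : ∀ S, ∀ x : supportedOn S, ‖x‖ = 1 → ∃ q ∈ N S, ‖x - q‖ ≤ δ / 3)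
    (hN : ∀ S : Finset (Fin n), S.card = s → ∀ q ∈ N S,
      |‖WithLp.toLp 1 (A *ᵥ q.1.ofLp)‖ - 1| ≤ δ / 3) :
    SatisfiesRIP A s δ := by
  classical
  intro x hx
  have hcard : (Function.support x).toFinset.card ≤ s := by
    rw [← Set.ncard_eq_toFinset_card']
    exact hx
  obtain ⟨S, hxS, hS⟩ := Finset.exists_superset_card_eq hcard (by simpa using hsn)
  have hmem : WithLp.toLp 2 x ∈ supportedOn S := by
    intro j hj
    by_contra hne
    exact hj (hxS (by simpa using hne))
  exact norm_bounds_of_net (mulVecSupported A S) hδ0 hδ1 (hnet S) (hN S hS) ⟨_, hmem⟩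

/-- The strict form of `(n.choose s) ≤ (e n / s) ^ s`, by Stirling's lower bound. -/
lemma choose_lt_exp_mul_div_pow {n s : ℕ} (hs : 1 ≤ s) (hsn : s ≤ n) :
    (n.choose s : ℝ) < (Real.exp 1 * n / s) ^ s := by
  have hs' : (1 : ℝ) ≤ s := by exact_mod_cast hs
  have hn' : (0 : ℝ) < n := by exact_mod_cast (by omega : 0 < n)
  have hpos : 0 < ((s : ℝ) / Real.exp 1) ^ s := by positivity
  have hsqrt : 1 < √(2 * Real.pi * s) := by
    rw [Real.lt_sqrt zero_le_one]
    nlinarith [Real.pi_gt_three]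
  have hfac : ((s : ℝ) / Real.exp 1) ^ s < s.factorial :=
    (lt_mul_of_one_lt_left hpos hsqrt).trans_le (Stirling.le_factorial_stirling s)
  calc (n.choose s : ℝ) ≤ (n : ℝ) ^ s / s.factorial := Nat.choose_le_pow_div s n
    _ < (n : ℝ) ^ s / ((s : ℝ) / Real.exp 1) ^ s := by gcongr
    _ = (Real.exp 1 * n / s) ^ s := by
        rw [← div_pow]
        congr 1
        field_simp

/-! ### The union bound -/

theorem mainTheorem1 {Ω : Type*} [MeasurableSpace Ω] (P : Measure Ω) [IsProbabilityMeasure P]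
    (m n s : ℕ) (hs : 1 ≤ s) (hsn : s ≤ n)
    (δ η σ : ℝ) (hδ : δ ∈ Set.Ioo (0 : ℝ) 1) (hη : η ∈ Set.Ioo (0 : ℝ) 1)
    (hσ : σ = 1 / (m : ℝ) * (√2 / √Real.pi))
    (Φ : Ω → Matrix (Fin m) (Fin n) ℂ)
    (hΦ : IsComplexGaussianMatrix P 0 (2 * σ ^ 2).toNNReal Φ)
    (hm : (m : ℝ) ≥ 36 / Real.pi * (δ ^ 2)⁻¹ *
      ((s : ℝ) * Real.log (Real.exp 1 * (n : ℝ) / (s : ℝ) * (1 + 6 / δ) ^ 2)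
        + Real.log (2 / η))) :
    1 - η < P.real {ω | SatisfiesRIP (Φ ω) s δ} := by
  classical
  obtain ⟨hδ0, hδ1⟩ := hδ
  obtain ⟨hη0, hη1⟩ := hη
  have hpi := Real.pi_pos
  have hs' : (1 : ℝ) ≤ s := by exact_mod_cast hs
  have hsn' : (s : ℝ) ≤ n := by exact_mod_cast hsn
  have hn' : (0 : ℝ) < n := by linarith
  set B : ℝ := Real.exp 1 * (n : ℝ) / (s : ℝ) * (1 + 6 / δ) ^ 2 with hB
  have hB0 : 0 < B := by positivity
  have hB1 : 1 ≤ B := by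
    have h1 : (1 : ℝ) ≤ Real.exp 1 * n / s := by
      rw [le_div_iff₀ (by linarith)]
      nlinarith [Real.add_one_le_exp (1 : ℝ)]
    have h2 : (1 : ℝ) ≤ (1 + 6 / δ) ^ 2 := one_le_pow₀ (by linarith [show 0 < 6 / δ by positivity])
    exact one_le_mul_of_one_le_of_one_le h1 h2
  have hlog : 0 < s * Real.log B + Real.log (2 / η) := by
    have h1 : 0 < Real.log (2 / η) := Real.log_pos (by rw [lt_div_iff₀ hη0]; linarith)
    have h2 := Real.log_nonneg hB1
    positivity
  have hm0 : 0 < m := by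
    have : (0 : ℝ) < m := lt_of_lt_of_le (by positivity) hm
    exact_mod_cast this
  -- the failure probability of one net point
  set τ : ℝ := 2 * Real.exp (-(Real.pi * m * (δ / 3) ^ 2 / 4)) with hτ
  have hτ0 : 0 < τ := by positivity
  have hτle : B ^ s * τ ≤ η := by
    have h1 : s * Real.log B + Real.log (2 / η) ≤ Real.pi * m * (δ / 3) ^ 2 / 4 := by
      have := mul_le_mul_of_nonneg_left hm (show 0 ≤ Real.pi * δ ^ 2 / 36 by positivity)
      calc s * Real.log B + Real.log (2 / η)
          = Real.pi * δ ^ 2 / 36 * (36 / Real.pi * (δ ^ 2)⁻¹ *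
              (s * Real.log B + Real.log (2 / η))) := by field_simp
        _ ≤ _ := this
        _ = _ := by ring
    have h2 : B ^ s * (2 / η) ≤ Real.exp (Real.pi * m * (δ / 3) ^ 2 / 4) := by
      rw [← Real.log_le_iff_le_exp (by positivity), Real.log_mul (by positivity) (by positivity),
        Real.log_pow]
      exact h1
    rw [hτ, Real.exp_neg, ← mul_assoc, ← div_eq_mul_inv, div_le_iff₀ (Real.exp_pos _)]
    calc B ^ s * 2 = η * (B ^ s * (2 / η)) := by field_simp
      _ ≤ _ := mul_le_mul_of_nonneg_left h2 hη0.le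
  choose N hN1 hNnet hNcard using fun S : Finset (Fin n) =>
    exists_net_unit_sphere (supportedOn S) (ρ := δ / 3) (by positivity)
  have hNcard' : ∀ S : Finset (Fin n), S.card = s → ((N S).card : ℝ) ≤ ((1 + 6 / δ) ^ 2) ^ s := by
    intro S hS
    refine (hNcard S).trans ?_
    rw [show 2 / (δ / 3) = 6 / δ by field_simp; norm_num, ← pow_mul]
    refine pow_le_pow_right₀ (by linarith [show 0 < 6 / δ by positivity]) ?_
    rw [← hS]
    exact finrank_real_supportedOn_le S
  let bad : (S : Finset (Fin n)) → supportedOn S → Set Ω := fun S q =>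
    {ω | δ / 3 ≤ |‖WithLp.toLp 1 (Φ ω *ᵥ q.1.ofLp)‖ - 1|}
  have hsub : {ω | SatisfiesRIP (Φ ω) s δ}ᶜ ⊆
      ⋃ S ∈ Finset.powersetCard s Finset.univ, ⋃ q ∈ N S, bad S q := by
    intro ω hω
    by_contra hcon
    simp only [Set.mem_iUnion, not_exists] at hcon
    refine hω (satisfiesRIP_of_net hsn (Φ ω) hδ0 hδ1 N hNnet fun S hS q hq => ?_)
    have := hcon S (Finset.mem_powersetCard.2 ⟨Finset.subset_univ _, hS⟩) q hq
    exact (not_le.1 this).le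
  have hbad : P.real {ω | SatisfiesRIP (Φ ω) s δ}ᶜ < η := by
    calc P.real {ω | SatisfiesRIP (Φ ω) s δ}ᶜ
        ≤ P.real (⋃ S ∈ Finset.powersetCard s Finset.univ, ⋃ q ∈ N S, bad S q) :=
          measureReal_mono hsub (measure_ne_top _ _)
      _ ≤ ∑ S ∈ Finset.powersetCard s Finset.univ, P.real (⋃ q ∈ N S, bad S q) :=
          measureReal_biUnion_finset_le _ _
      _ ≤ ∑ S ∈ Finset.powersetCard s (Finset.univ : Finset (Fin n)),
            ((1 + 6 / δ) ^ 2) ^ s * τ := by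
          refine Finset.sum_le_sum fun S hS => (measureReal_biUnion_finset_le _ _).trans ?_
          calc ∑ q ∈ N S, P.real (bad S q) ≤ ∑ _q ∈ N S, τ :=
                Finset.sum_le_sum fun q hq =>
                  measureReal_abs_norm_mulVec_sub_one_ge_le hm0 hσ hΦ q.1 (hN1 S q hq)
                    (by positivity)
            _ = (N S).card * τ := by rw [Finset.sum_const, nsmul_eq_mul]
            _ ≤ _ := mul_le_mul_of_nonneg_right
                (hNcard' S (Finset.mem_powersetCard.1 hS).2) hτ0.le
      _ = n.choose s * (((1 + 6 / δ) ^ 2) ^ s * τ) := by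
          rw [Finset.sum_const, Finset.card_powersetCard, Finset.card_univ, Fintype.card_fin,
            nsmul_eq_mul]
      _ < (Real.exp 1 * n / s) ^ s * (((1 + 6 / δ) ^ 2) ^ s * τ) :=
          mul_lt_mul_of_pos_right (choose_lt_exp_mul_div_pow hs hsn) (by positivity)
      _ = B ^ s * τ := by rw [hB, mul_pow, mul_assoc]
      _ ≤ η := hτle
  -- subadditivity, which needs no measurability of the event
  have hone := measureReal_union_le (μ := P) {ω | SatisfiesRIP (Φ ω) s δ}
    {ω | SatisfiesRIP (Φ ω) s δ}ᶜ
  rw [Set.union_compl_self, probReal_univ] at hone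
  linarith
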